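/- **Setting.** Let $\mathcal T_h$ be a finite nonempty conforming partition, in general nonuniform, into closed axis-parallel rectangles of positive side lengths (two different elements are disjoint, or meet exactly in a common vertex or a common edge), and let $\Omega\subset\mathbb R^2$ be the interior of the union of the elements. For $T\in\mathcal T_h$ let $h_x,h_y$ be its side lengths, $|T|=h_xh_y$, $\sigma=h_x/h_y$, $(x_T,y_T)$ its center, $e_1,e_2,e_3,e_4$ its left, right, bottom and top edges, $M_i$ the midpoint and $n_i$ the outward unit normal of $e_i$, and let $h$ be the largest element diameter. Let $W_h$ be the space of functions that are constant on each edge of the mesh (single-valued on shared edges), and $W_h^0\subset W_h$ those vanishing on the edges lying on $\partial\Omega$. For $v\in W_h$ with values $v_i$ on $e_i$, the weak gradient on $T$ is $\nabla_w v=|T|^{-1}\sum_{i=1}^4 v_i|e_i|n_i$, and $\mathfrak s(v)$ is the polynomial of degree at most one on $T$ with $\sum_{i=1}^4(\mathfrak s(v)(M_i)-v_i)\phi(M_i)|e_i|=0$ for all polynomials $\phi$ of degree at most one. Consider $-\nabla\cdot(\alpha\nabla u)+\beta\cdot\nabla u+cu=f$ in $\Omega$, $u=g$ on $\partial\Omega$,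 where $\alpha\in L^1(\Omega)$, $\alpha\ge\alpha_0$ in $\Omega$ for a constant $\alpha_0>0$, $\beta\in[L^\infty(\Omega)]^2$, $c$ is constant in the interior of each element, and $g$ is integrable on each boundary edge. Let $\kappa\ge0$ be the stabilization parameter. With $(\cdot,\cdot)_T$ the $L^2(T)$ inner product and $Q_bg$ the average of $g$ on each boundary edge, $u_b\in W_h$ solves the computational SWG scheme if $u_b=Q_bg$ on the boundary edges and, for all $v\in W_h^0$, $$\sum_{T\in\mathcal T_h}\Big[\frac{\kappa}{h}\sum_{i=1}^4(\mathfrak s(u_b)(M_i)-u_{b,i})(\mathfrak s(v)(M_i)-v_i)|e_i|+(\alpha\nabla_wu_b,\nabla_wv)_T+(\beta\cdot\nabla_wu_b,\mathfrak s(v))_T+(c\,\mathfrak s(u_b),\mathfrak s(v))_T\Big]=\sum_{T\in\mathcal T_h}(f,\mathfrak s(v))_{h,T},$$ $$(f,\mathfrak s(v))_{h,T}=\frac{|T|}6\sum_{i=1}^4f(M_i)v_i+\frac{|T|}{6(1+\sigma)}f(x_T,y_T)\big((2-\sigma)(v_1+v_2)+(2\sigma-1)(v_3+v_4)\big).$$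 **Theorem 3.1 (discrete maximum principle).** There are absolute constants $C_0,C_1>0$ with the following property. Let $u_b$ be any solution of the computational SWG scheme and assume that 1. on every element $T$ and at every point of its interior, $$\min\Big(\alpha\sigma-\frac{\kappa h_x}{2h(1+\sigma)},\ \alpha\sigma^{-1}-\frac{\kappa h_x}{2h(1+\sigma)}\Big)\ \ge\ C_0\|\beta\|_\infty h+C_1\|c\|_\infty h^2;$$ 2. the meshsize is small relative to $\kappa$ in the sense that $C_0\|\beta\|_\infty h+C_1\|c\|_\infty h^2\le\kappa$ (for fixed $\kappa>0$ and bounded $\beta,c$ this holds for all sufficiently small $h$, and it is void if $\beta=0$ and $c=0$); 3. every element has aspect ratio $\sigma\in[0.5,2]$; 4. $f\le0$ in $\Omega$. Let $\Omega_h$ be the set of edge midpoints and $\partial\Omega_h$ the set of those on $\partial\Omega$. Then: (a) if $c=0$ in $\Omega$, then $\displaystyle\max_{\Omega_h}u_b\le\max_{\partial\Omega_h}Q_bg$; (b) if $c\ge0$ in $\Omega$, then $\displaystyle\max_{\Omega_h}u_b\le\max_{\partial\Omega_h}\max(Q_bg,0)$. -/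

import Mathlib

open MeasureTheory Set
open scoped ENNReal

noncomputable section

namespace SWG

/-- A segment parallel to a coordinate axis: `vert x y₀ y₁` is `{x} × [y₀, y₁]` and
`horiz y x₀ x₁` is `[x₀, x₁] × {y}`. -/
inductive Seg where
  | vert (x y₀ y₁ : ℝ)
  | horiz (y x₀ x₁ : ℝ)

namespace Seg

def toSet : Seg → Set (ℝ × ℝ)
  | vert x y₀ y₁ => {x} ×ˢ Icc y₀ y₁
  | horiz y x₀ x₁ => Icc x₀ x₁ ×ˢ {y}

def length : Seg → ℝ
  | vert _ y₀ y₁ => y₁ - y₀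
  | horiz _ x₀ x₁ => x₁ - x₀

def midpoint : Seg → ℝ × ℝ
  | vert x y₀ y₁ => (x, (y₀ + y₁) / 2)
  | horiz y x₀ x₁ => ((x₀ + x₁) / 2, y)

/-- `g` is integrable along the segment (with respect to arc length). -/
def IntegrableAlong (g : ℝ × ℝ → ℝ) : Seg → Prop
  | vert x y₀ y₁ => IntervalIntegrable (fun y => g (x, y)) volume y₀ y₁
  | horiz y x₀ x₁ => IntervalIntegrable (fun x => g (x, y)) volume x₀ x₁

/-- The integral of `g` along the segment (with respect to arc length). -/
def integral (g : ℝ × ℝ → ℝ) : Seg → ℝ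
  | vert x y₀ y₁ => ∫ y in y₀..y₁, g (x, y)
  | horiz y x₀ x₁ => ∫ x in x₀..x₁, g (x, y)

/-- `Q_b g`: the average of `g` over the segment. -/
def Qb (g : ℝ × ℝ → ℝ) (e : Seg) : ℝ := e.integral g / e.length

end Seg

/-- The closed rectangle `[x₀, x₁] × [y₀, y₁]`, with nonempty interior. -/
structure Rect where
  x₀ : ℝ
  x₁ : ℝ
  y₀ : ℝ
  y₁ : ℝ
  hx_lt : x₀ < x₁
  hy_lt : y₀ < y₁

namespace Rect

variable (T : Rect)

def toSet : Set (ℝ × ℝ) := Icc T.x₀ T.x₁ ×ˢ Icc T.y₀ T.y₁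

/-- The interior of the rectangle. All area integrals over an element are taken over its interior;
this is the same as integrating over the closed element, since the edges are null sets, and it uses
only values of the coefficients inside the domain. -/
def inside : Set (ℝ × ℝ) := Ioo T.x₀ T.x₁ ×ˢ Ioo T.y₀ T.y₁

def hx : ℝ := T.x₁ - T.x₀

def hy : ℝ := T.y₁ - T.y₀

def area : ℝ := T.hx * T.hy

/-- The (Euclidean) diameter `h_T`. -/
def diam : ℝ := Real.sqrt (T.hx ^ 2 + T.hy ^ 2)

/-- The aspect ratio `σ = h_x / h_y`. -/
def aspect : ℝ := T.hx / T.hy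

def center : ℝ × ℝ := ((T.x₀ + T.x₁) / 2, (T.y₀ + T.y₁) / 2)

def vertices : Set (ℝ × ℝ) :=
  {(T.x₀, T.y₀), (T.x₁, T.y₀), (T.x₀, T.y₁), (T.x₁, T.y₁)}

/-- The four edges, in the order left, right, bottom, top. -/
def edge : Fin 4 → Seg :=
  ![.vert T.x₀ T.y₀ T.y₁, .vert T.x₁ T.y₀ T.y₁, .horiz T.y₀ T.x₀ T.x₁, .horiz T.y₁ T.x₀ T.x₁]

/-- The outward unit normals on the four edges. -/
def normal : Fin 4 → EuclideanSpace ℝ (Fin 2) :=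
  ![!₂[-1, 0], !₂[1, 0], !₂[0, -1], !₂[0, 1]]

/-- The weak gradient `∇_w v = |T|⁻¹ ∑ᵢ vᵢ |eᵢ| nᵢ` of a piecewise constant function on `∂T`, given
by its four edge values. -/
def weakGrad (v : Fin 4 → ℝ) : EuclideanSpace ℝ (Fin 2) :=
  T.area⁻¹ • ∑ i, (v i * (T.edge i).length) • normal i

/-- The linear extension `𝔰(v)` to `T` of a piecewise constant function `v` on `∂T`, in closed form;
`extension_iff` shows that it is the unique polynomial of degree at most one with
`∑ᵢ (𝔰(v)(Mᵢ) - vᵢ) φ(Mᵢ) |eᵢ| = 0` for all polynomials `φ` of degree at most one. -/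
def extension (v : Fin 4 → ℝ) (p : ℝ × ℝ) : ℝ :=
  (T.hy * (v 0 + v 1) + T.hx * (v 2 + v 3)) / (2 * T.hy + 2 * T.hx)
    + (v 1 - v 0) / T.hx * (p.1 - T.center.1) + (v 3 - v 2) / T.hy * (p.2 - T.center.2)

theorem extension_iff (v : Fin 4 → ℝ) (k₀ k₁ k₂ : ℝ) :
    (∀ l₀ l₁ l₂ : ℝ, ∑ i, (k₀ + k₁ * (T.edge i).midpoint.1 + k₂ * (T.edge i).midpoint.2 - v i) *
        (l₀ + l₁ * (T.edge i).midpoint.1 + l₂ * (T.edge i).midpoint.2) * (T.edge i).length = 0) ↔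
      ∀ p : ℝ × ℝ, k₀ + k₁ * p.1 + k₂ * p.2 = T.extension v p := by
  have h1 : (0 : ℝ) < T.hx := sub_pos.2 T.hx_lt
  have h2 : (0 : ℝ) < T.hy := sub_pos.2 T.hy_lt
  have e1 : T.x₁ = T.x₀ + T.hx := by simp [hx]
  have e2 : T.y₁ = T.y₀ + T.hy := by simp [hy]
  simp only [Fin.sum_univ_four, edge, Seg.midpoint, Seg.length, extension, center,
    Matrix.cons_val_zero, Matrix.cons_val_one, Matrix.cons_val, Fin.isValue]
  simp only [e1, e2]
  generalize T.hx = a at *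
  generalize T.hy = b at *
  generalize T.x₀ = x at *
  generalize T.y₀ = y at *
  clear e1 e2
  constructor
  · intro h
    have E1 := h 1 0 0
    have E2 := h (-(x + a / 2)) 1 0
    have E3 := h (-(y + b / 2)) 0 1
    have hk1 : k₁ = (v 1 - v 0) / a := by
      rw [eq_div_iff h1.ne']
      have : (a * b) * (k₁ * a - (v 1 - v 0)) = 0 := by linear_combination 2 * E2
      have := (mul_eq_zero.1 this).resolve_left (by positivity)
      linarith
    have hk2 : k₂ = (v 3 - v 2) / b := by
      rw [eq_div_iff h2.ne']
      have : (a * b) * (k₂ * b - (v 3 - v 2)) = 0 := by linear_combination 2 * E3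
      have := (mul_eq_zero.1 this).resolve_left (by positivity)
      linarith
    have hk0 : k₀ + k₁ * (x + a / 2) + k₂ * (y + b / 2)
        = (b * (v 0 + v 1) + a * (v 2 + v 3)) / (2 * b + 2 * a) := by
      rw [eq_div_iff (by positivity)]
      linear_combination E1
    intro p
    rw [← hk0, ← hk1, ← hk2]
    ring
  · intro h l₀ l₁ l₂
    have H : ∀ s t : ℝ, k₀ + k₁ * s + k₂ * t = _ := fun s t => h (s, t)
    simp only [H]
    field_simp
    ring

end Rect

/-- A conforming rectangular partition: a finite nonempty set of axis-parallel rectangles such that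
two different elements are disjoint or meet exactly in a common vertex or in a common edge. -/
structure RectMesh where
  elems : Finset Rect
  elems_nonempty : elems.Nonempty
  conforming : ∀ T ∈ elems, ∀ T' ∈ elems, T ≠ T' →
    T.toSet ∩ T'.toSet = ∅ ∨
    (∃ p ∈ T.vertices ∩ T'.vertices, T.toSet ∩ T'.toSet = {p}) ∨
    (∃ i j, T.edge i = T'.edge j ∧ T.toSet ∩ T'.toSet = (T.edge i).toSet)

namespace RectMesh

variable (M : RectMesh)

/-- The open domain `Ω` partitioned by the mesh. -/
def domain : Set (ℝ × ℝ) := interior (⋃ T ∈ M.elems, T.toSet)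

/-- The meshsize `h`, the largest diameter of an element. -/
def meshSize : ℝ := M.elems.sup' M.elems_nonempty Rect.diam

/-- The edges of the mesh. An edge shared by two elements occurs once. -/
def Edge : Type := {e : Seg // ∃ T ∈ M.elems, ∃ i, T.edge i = e}

/-- The global space `W(𝒯_h)`: one constant on every edge of the mesh. -/
abbrev EdgeFun : Type := M.Edge → ℝ

/-- The edge lies on `∂Ω`, i.e. its midpoint does. -/
def IsBoundaryEdge {M : RectMesh} (e : M.Edge) : Prop := e.1.midpoint ∈ frontier M.domain

variable {M}

/-- The restriction of a global function to the boundary of an element. -/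
def EdgeFun.loc (v : M.EdgeFun) (T : {T // T ∈ M.elems}) : Fin 4 → ℝ :=
  fun i => v ⟨T.1.edge i, T.1, T.2, i, rfl⟩

/-- The stabilizer `S_T`, with the meshsize `h` of the whole partition. -/
def stabT (h : ℝ) (T : Rect) (u v : Fin 4 → ℝ) : ℝ :=
  h⁻¹ * ∑ i, (T.extension u (T.edge i).midpoint - u i) *
    (T.extension v (T.edge i).midpoint - v i) * (T.edge i).length

/-- `a_T(u, v) = (α ∇_w u, ∇_w v)_T`. -/
def aT (α : ℝ × ℝ → ℝ) (T : Rect) (u v : Fin 4 → ℝ) : ℝ :=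
  ∫ p in T.inside, α p * inner ℝ (T.weakGrad u) (T.weakGrad v)

/-- `b_T(u, v) = (β · ∇_w u, 𝔰(v))_T`. -/
def bT (β : ℝ × ℝ → EuclideanSpace ℝ (Fin 2)) (T : Rect) (u v : Fin 4 → ℝ) : ℝ :=
  ∫ p in T.inside, inner ℝ (β p) (T.weakGrad u) * T.extension v p

/-- `c_T(u, v) = (c 𝔰(u), 𝔰(v))_T`. -/
def cT (c : ℝ × ℝ → ℝ) (T : Rect) (u v : Fin 4 → ℝ) : ℝ :=
  ∫ p in T.inside, c p * T.extension u p * T.extension v p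

/-- The bilinear form `𝒜 = κ S + ∑_T (a_T + b_T + c_T)`. -/
def formA (κ : ℝ) (α : ℝ × ℝ → ℝ) (β : ℝ × ℝ → EuclideanSpace ℝ (Fin 2)) (c : ℝ × ℝ → ℝ)
    (u v : M.EdgeFun) : ℝ :=
  κ * (∑ T : {T // T ∈ M.elems}, stabT M.meshSize T.1 (u.loc T) (v.loc T)) +
    ∑ T : {T // T ∈ M.elems}, (aT α T.1 (u.loc T) (v.loc T) + bT β T.1 (u.loc T) (v.loc T) +
      cT c T.1 (u.loc T) (v.loc T))

/-- The computational load `(f, 𝔰(v))_{h,T}` given by numerical integration. -/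
def loadT (f : ℝ × ℝ → ℝ) (T : Rect) (v : Fin 4 → ℝ) : ℝ :=
  T.area / 6 * ∑ i, f (T.edge i).midpoint * v i +
    T.area / (6 * (1 + T.aspect)) * f T.center *
      ((2 - T.aspect) * (v 0 + v 1) + (2 * T.aspect - 1) * (v 2 + v 3))

/-- `u` solves the computational simplified weak Galerkin scheme: `u = Q_b g` on the boundary edges
and `𝒜(u, v) = ∑_T (f, 𝔰(v))_{h,T}` for all `v` vanishing on the boundary edges. -/
def IsSWGSolution (κ : ℝ) (α : ℝ × ℝ → ℝ) (β : ℝ × ℝ → EuclideanSpace ℝ (Fin 2))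
    (c f g : ℝ × ℝ → ℝ) (u : M.EdgeFun) : Prop :=
  (∀ e : M.Edge, IsBoundaryEdge e → u e = e.1.Qb g) ∧
    ∀ v : M.EdgeFun, (∀ e : M.Edge, IsBoundaryEdge e → v e = 0) →
      formA κ α β c u v = ∑ T : {T // T ∈ M.elems}, loadT f T.1 (v.loc T)

variable (M)

/-- `c` is piecewise constant with respect to the mesh. -/
def PiecewiseConst (c : ℝ × ℝ → ℝ) : Prop :=
  ∀ T ∈ M.elems, ∃ k : ℝ, ∀ p ∈ T.inside, c p = k

/-- The norm of `L^∞(Ω)`. -/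
def normInf {E : Type*} [NormedAddCommGroup E] (φ : ℝ × ℝ → E) : ℝ :=
  (eLpNorm φ ∞ (volume.restrict M.domain)).toReal

/-- The quantity `C₀ ‖β‖_∞ h + C₁ ‖c‖_∞ h²`. -/
def lowerOrder (C₀ C₁ : ℝ) (β : ℝ × ℝ → EuclideanSpace ℝ (Fin 2)) (c : ℝ × ℝ → ℝ) : ℝ :=
  C₀ * M.normInf β * M.meshSize + C₁ * M.normInf c * M.meshSize ^ 2

/-- The condition
`min (α σ - κ h_x / (2 h (1 + σ))) (α σ⁻¹ - κ h_x / (2 h (1 + σ))) ≥ C₀ ‖β‖_∞ h + C₁ ‖c‖_∞ h²`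
on every element, at every point of the element if `α` varies. -/
def KappaCond (C₀ C₁ κ : ℝ) (α : ℝ × ℝ → ℝ) (β : ℝ × ℝ → EuclideanSpace ℝ (Fin 2))
    (c : ℝ × ℝ → ℝ) : Prop :=
  ∀ T ∈ M.elems, ∀ p ∈ T.inside,
    M.lowerOrder C₀ C₁ β c ≤
      min (α p * T.aspect - κ * T.hx / (2 * M.meshSize * (1 + T.aspect)))
        (α p * T.aspect⁻¹ - κ * T.hx / (2 * M.meshSize * (1 + T.aspect)))

end RectMesh

end SWG

end

/-! The scheme is tested with the basis function of an interior edge at which `u` attains its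
maximum `K`. On an element containing this edge everything is expressed through the nonnegative
deficits `K - u_j`: `d` on the opposite edge, `e₁`, `e₂` on the two adjacent ones. Stabilizer and
diffusion give `(J - s) d + s (e₁ + e₂)`, where `s = κ h_x / (2 h (1 + σ))` and `J` is `∫ α` over
`h_x²` or `h_y²`. The first condition yields `J - s ≥ L`, with `L` the lower-order quantity; the
second, with the bounds on `σ`, makes `s` large enough to absorb the convection and reaction terms
multiplying `e₁ + e₂`. Hence each element contributes a nonnegative amount (`localForm_single`).

The load is nonpositive (`loadT_single_nonpos`), so every contribution vanishes. If `κ > 0`, this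
forces `e₁ = e₂ = 0`; if `κ = 0`, then `L = 0` and `d = 0`. Either way, as long as no maximal edge
lies on `∂Ω`, the value `K` passes to opposite edges, for `κ > 0` by two moves through an adjacent
edge. A rightmost vertical or topmost horizontal maximal edge then gives a contradiction
(`exists_isBoundaryEdge`). -/

namespace SWG

/-! ### Geometry, linear extension and weak gradient on one rectangle -/

namespace Rect

variable (T : Rect)

theorem hx_pos : 0 < T.hx := sub_pos.2 T.hx_lt

theorem hy_pos : 0 < T.hy := sub_pos.2 T.hy_lt

theorem area_pos : 0 < T.area := mul_pos T.hx_pos T.hy_pos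

theorem aspect_pos : 0 < T.aspect := div_pos T.hx_pos T.hy_pos

theorem hx_le_diam : T.hx ≤ T.diam :=
  Real.le_sqrt_of_sq_le (by nlinarith [sq_nonneg T.hy])

theorem hy_le_diam : T.hy ≤ T.diam :=
  Real.le_sqrt_of_sq_le (by nlinarith [sq_nonneg T.hx])

theorem edge_injective : Function.Injective T.edge := by
  have h1 := T.hx_lt.ne
  have h2 := T.hy_lt.ne
  intro i j
  fin_cases i <;> fin_cases j <;> simp [edge, h1, h2, h1.symm, h2.symm]

theorem measurableSet_inside : MeasurableSet T.inside :=
  measurableSet_Ioo.prod measurableSet_Ioo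

theorem isOpen_inside : IsOpen T.inside := isOpen_Ioo.prod isOpen_Ioo

theorem isClosed_toSet : IsClosed T.toSet := isClosed_Icc.prod isClosed_Icc

theorem inside_subset_toSet : T.inside ⊆ T.toSet :=
  prod_mono Ioo_subset_Icc_self Ioo_subset_Icc_self

theorem closure_inside : closure T.inside = T.toSet := by
  rw [inside, closure_prod_eq, closure_Ioo T.hx_lt.ne, closure_Ioo T.hy_lt.ne, toSet]

theorem inside_ae_eq_toSet : T.inside =ᵐ[volume] T.toSet := by
  rw [Measure.volume_eq_prod]
  exact Measure.set_prod_ae_eq Ioo_ae_eq_Icc Ioo_ae_eq_Icc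

theorem center_mem_inside : T.center ∈ T.inside := by
  have h1 := T.hx_lt
  have h2 := T.hy_lt
  refine ⟨⟨?_, ?_⟩, ⟨?_, ?_⟩⟩ <;> simp only [center] <;> linarith

theorem midpoint_edge_mem_toSet (i : Fin 4) : (T.edge i).midpoint ∈ T.toSet := by
  have h1 := T.hx_lt
  have h2 := T.hy_lt
  fin_cases i <;> refine ⟨⟨?_, ?_⟩, ⟨?_, ?_⟩⟩ <;> simp [edge, Seg.midpoint] <;> linarith

theorem volume_inside : volume T.inside = ENNReal.ofReal T.area := by
  rw [inside, Measure.volume_eq_prod, Measure.prod_prod, Real.volume_Ioo, Real.volume_Ioo,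
    ← ENNReal.ofReal_mul (sub_nonneg.2 T.hx_lt.le)]
  rfl

theorem volume_inside_lt_top : volume T.inside < ∞ := by
  rw [volume_inside]; exact ENNReal.ofReal_lt_top

theorem measureReal_inside : volume.real T.inside = T.area := by
  rw [Measure.real, volume_inside, ENNReal.toReal_ofReal T.area_pos.le]

/-- The extension is linear and reproduces constants. With `k` the maximal value, this passes to
deficits. -/
theorem extension_eq_add_sub (v : Fin 4 → ℝ) (k : ℝ) (p : ℝ × ℝ) :
    T.extension v p = k - T.extension (fun j => k - v j) p := by
  have h1 := T.hx_pos
  have h2 := T.hy_pos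
  simp only [extension]
  field_simp
  ring

/-- In centered, scaled coordinates `ξ`, `η`, the coefficients of the edge values are `θ ∓ ξ` and
`1/2 - θ ∓ η`, all of modulus at most one. -/
theorem abs_extension_le (v : Fin 4 → ℝ) {p : ℝ × ℝ} (hp : p ∈ T.inside) :
    |T.extension v p| ≤ ∑ i, |v i| := by
  have h1 := T.hx_pos
  have h2 := T.hy_pos
  obtain ⟨⟨hp1, hp2⟩, hp3, hp4⟩ := hp
  set ξ := (p.1 - T.center.1) / T.hx with hξ
  set η := (p.2 - T.center.2) / T.hy with hη
  set θ := T.hy / (2 * T.hy + 2 * T.hx) with hθ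
  have hξ' : |ξ| ≤ 1 / 2 := by
    rw [hξ, abs_div, abs_of_pos h1, div_le_iff₀ h1, abs_le]
    simp only [center, hx]
    constructor <;> linarith
  have hη' : |η| ≤ 1 / 2 := by
    rw [hη, abs_div, abs_of_pos h2, div_le_iff₀ h2, abs_le]
    simp only [center, hy]
    constructor <;> linarith
  have hθ0 : 0 ≤ θ := by positivity
  have hθ1 : θ ≤ 1 / 2 := by
    rw [hθ, div_le_iff₀ (by positivity)]; linarith
  have hext : T.extension v p
      = (θ - ξ) * v 0 + (θ + ξ) * v 1 + (1 / 2 - θ - η) * v 2 + (1 / 2 - θ + η) * v 3 := by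
    simp only [extension, hξ, hη, hθ]
    field_simp
    ring
  have key : ∀ a b : ℝ, |a| ≤ 1 → |a * b| ≤ |b| := fun a b h => by
    rw [abs_mul]; exact mul_le_of_le_one_left (abs_nonneg b) h
  rw [abs_le] at hξ' hη'
  rw [hext, Fin.sum_univ_four]
  have k0 := key (θ - ξ) (v 0) (abs_le.2 ⟨by linarith, by linarith⟩)
  have k1 := key (θ + ξ) (v 1) (abs_le.2 ⟨by linarith, by linarith⟩)
  have k2 := key (1 / 2 - θ - η) (v 2) (abs_le.2 ⟨by linarith, by linarith⟩)
  have k3 := key (1 / 2 - θ + η) (v 3) (abs_le.2 ⟨by linarith, by linarith⟩)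
  refine (abs_add_le _ _).trans (add_le_add ((abs_add_le _ _).trans
    (add_le_add ((abs_add_le _ _).trans (add_le_add k0 k1)) k2)) k3)

theorem abs_extension_single_le (i : Fin 4) {p : ℝ × ℝ} (hp : p ∈ T.inside) :
    |T.extension (Pi.single i 1) p| ≤ 1 := by
  refine (T.abs_extension_le _ hp).trans_eq ?_
  fin_cases i <;> simp [Fin.sum_univ_four, Pi.single_apply]

theorem continuous_extension (v : Fin 4 → ℝ) : Continuous (T.extension v) := by
  unfold extension
  fun_prop

theorem integrableOn_inside_of_continuous {φ : ℝ × ℝ → ℝ} (h : Continuous φ) :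
    IntegrableOn φ T.inside :=
  (h.continuousOn.integrableOn_compact (isCompact_Icc.prod isCompact_Icc)).mono_set
    T.inside_subset_toSet

theorem integral_extension (v : Fin 4 → ℝ) :
    ∫ p in T.inside, T.extension v p =
      T.area * ((T.hy * (v 0 + v 1) + T.hx * (v 2 + v 3)) / (2 * T.hy + 2 * T.hx)) := by
  have centered : ∀ a b : ℝ, a ≤ b → ∫ x in Ioo a b, (x - (a + b) / 2) = 0 := fun a b h => by
    rw [← integral_Ioc_eq_integral_Ioo, ← intervalIntegral.integral_of_le h,
      intervalIntegral.integral_sub (by simp) (by simp), integral_id,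
      intervalIntegral.integral_const, smul_eq_mul]
    ring
  have h1 : ∫ p in T.inside, (p.1 - T.center.1) = 0 := by
    have := setIntegral_prod_mul (μ := (volume : Measure ℝ)) (ν := (volume : Measure ℝ))
      (fun x => x - T.center.1) (fun _ => (1 : ℝ)) (Ioo T.x₀ T.x₁) (Ioo T.y₀ T.y₁)
    simp only [mul_one] at this
    rw [inside, Measure.volume_eq_prod, this, center, centered _ _ T.hx_lt.le, zero_mul]
  have h2 : ∫ p in T.inside, (p.2 - T.center.2) = 0 := by
    have := setIntegral_prod_mul (μ := (volume : Measure ℝ)) (ν := (volume : Measure ℝ))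
      (fun _ => (1 : ℝ)) (fun y => y - T.center.2) (Ioo T.x₀ T.x₁) (Ioo T.y₀ T.y₁)
    simp only [one_mul] at this
    rw [inside, Measure.volume_eq_prod, this, center, centered _ _ T.hy_lt.le, mul_zero]
  unfold extension
  rw [integral_add (T.integrableOn_inside_of_continuous (by fun_prop))
      (T.integrableOn_inside_of_continuous (by fun_prop)),
    integral_add (T.integrableOn_inside_of_continuous (by fun_prop))
      (T.integrableOn_inside_of_continuous (by fun_prop)),
    integral_const_mul, integral_const_mul, h1, h2, setIntegral_const, measureReal_inside,
    smul_eq_mul]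
  ring

theorem integral_extension_single_nonneg (i : Fin 4) :
    0 ≤ ∫ p in T.inside, T.extension (Pi.single i 1) p := by
  have h1 := T.hx_pos
  have h2 := T.hy_pos
  rw [integral_extension]
  refine mul_nonneg T.area_pos.le (div_nonneg ?_ (by positivity))
  fin_cases i <;> simp [h1.le, h2.le]

theorem weakGrad_eq (v : Fin 4 → ℝ) :
    T.weakGrad v = !₂[(v 1 - v 0) / T.hx, (v 3 - v 2) / T.hy] := by
  have h1 := T.hx_pos
  have h2 := T.hy_pos
  have e1 : T.x₁ - T.x₀ = T.hx := rfl
  have e2 : T.y₁ - T.y₀ = T.hy := rfl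
  ext k
  fin_cases k <;>
  · simp [weakGrad, Fin.sum_univ_four, normal, edge, Seg.length, area, e1, e2]
    field_simp
    ring

theorem norm_weakGrad_le (v : Fin 4 → ℝ) :
    ‖T.weakGrad v‖ ≤ |v 1 - v 0| / T.hx + |v 3 - v 2| / T.hy := by
  rw [weakGrad_eq, EuclideanSpace.norm_eq, Fin.sum_univ_two]
  have h1 : 0 ≤ |v 1 - v 0| / T.hx := div_nonneg (abs_nonneg _) T.hx_pos.le
  have h2 : 0 ≤ |v 3 - v 2| / T.hy := div_nonneg (abs_nonneg _) T.hy_pos.le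
  apply Real.sqrt_le_iff.2 ⟨by positivity, ?_⟩
  simp only [Real.norm_eq_abs, Matrix.cons_val_zero, Matrix.cons_val_one, abs_div,
    abs_of_pos T.hx_pos, abs_of_pos T.hy_pos]
  nlinarith [mul_nonneg h1 h2]

theorem inner_weakGrad (u v : Fin 4 → ℝ) :
    inner ℝ (T.weakGrad u) (T.weakGrad v) =
      (u 1 - u 0) * (v 1 - v 0) / T.hx ^ 2 + (u 3 - u 2) * (v 3 - v 2) / T.hy ^ 2 := by
  rw [weakGrad_eq, weakGrad_eq, EuclideanSpace.inner_eq_star_dotProduct]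
  simp [dotProduct, Fin.sum_univ_two]
  ring

/-- The edge opposite to a given one. -/
def opp : Fin 4 → Fin 4 := ![1, 0, 3, 2]

end Rect

/-! ### Local forms and the maximum principle on one element -/

namespace RectMesh

/-- The residual `𝔰(v)(Mᵢ) - vᵢ` is orthogonal to the three-dimensional space of linear polynomials
on four points, so the stabilizer has rank one. -/
theorem stabT_eq (h : ℝ) (T : Rect) (u v : Fin 4 → ℝ) :
    stabT h T u v = h⁻¹ * (T.area / (2 * (T.hx + T.hy))) *
      ((u 2 + u 3 - u 0 - u 1) * (v 2 + v 3 - v 0 - v 1)) := by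
  have h1 := T.hx_pos
  have h2 := T.hy_pos
  have e1 : T.x₁ = T.x₀ + T.hx := by simp [Rect.hx]
  have e2 : T.y₁ = T.y₀ + T.hy := by simp [Rect.hy]
  rw [stabT, mul_assoc]
  congr 1
  simp only [Fin.sum_univ_four, Rect.edge, Seg.midpoint, Seg.length, Rect.extension, Rect.center,
    Matrix.cons_val_zero, Matrix.cons_val_one, Matrix.cons_val, Fin.isValue, Rect.area]
  simp only [e1, e2]
  field_simp
  ring

theorem aT_eq (α : ℝ × ℝ → ℝ) (T : Rect) (u v : Fin 4 → ℝ) :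
    aT α T u v = (∫ p in T.inside, α p) *
      ((u 1 - u 0) * (v 1 - v 0) / T.hx ^ 2 + (u 3 - u 2) * (v 3 - v 2) / T.hy ^ 2) := by
  rw [aT, integral_mul_const, Rect.inner_weakGrad]

theorem abs_bT_single_le {β : ℝ × ℝ → EuclideanSpace ℝ (Fin 2)} {T : Rect} {B : ℝ}
    (hβ : ∀ᵐ p ∂volume.restrict T.inside, ‖β p‖ ≤ B) (w : Fin 4 → ℝ) (i : Fin 4) :
    |bT β T w (Pi.single i 1)| ≤ B * (T.hy * |w 1 - w 0| + T.hx * |w 3 - w 2|) := by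
  have h1 := T.hx_pos
  have h2 := T.hy_pos
  have key : ‖∫ p in T.inside, inner ℝ (β p) (T.weakGrad w) * T.extension (Pi.single i 1) p‖
      ≤ B * (|w 1 - w 0| / T.hx + |w 3 - w 2| / T.hy) * volume.real T.inside := by
    apply norm_setIntegral_le_of_norm_le_const_ae T.volume_inside_lt_top
    filter_upwards [hβ, ae_restrict_mem T.measurableSet_inside] with p hp hpT
    rw [norm_mul, ← mul_one (B * _)]
    refine mul_le_mul ?_ (T.abs_extension_single_le i hpT) (norm_nonneg _)
      (mul_nonneg ((norm_nonneg _).trans hp) (by positivity))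
    exact (norm_inner_le_norm _ _).trans (mul_le_mul hp (T.norm_weakGrad_le w) (norm_nonneg _)
      ((norm_nonneg _).trans hp))
  rw [T.measureReal_inside] at key
  refine key.trans_eq ?_
  rw [Rect.area]
  field_simp

/-- Write `𝔰(w) = w i - 𝔰(w i - w)`. The constant part has the sign of `k * w i`, because the
extended basis function has nonnegative mean; the rest is controlled by the deficits. -/
theorem neg_le_cT_single {c : ℝ × ℝ → ℝ} {T : Rect} {k : ℝ} (hc : ∀ p ∈ T.inside, c p = k)
    (hk : 0 ≤ k) {w : Fin 4 → ℝ} {i : Fin 4} (hw : ∀ j, w j ≤ w i) (hkw : 0 ≤ k * w i) :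
    -(k * T.area * ∑ j, (w i - w j)) ≤ cT c T w (Pi.single i 1) := by
  have e : cT c T w (Pi.single i 1) = k * w i * (∫ p in T.inside, T.extension (Pi.single i 1) p)
      - k * ∫ p in T.inside,
          T.extension (fun j => w i - w j) p * T.extension (Pi.single i 1) p := by
    have i₁ := (T.integrableOn_inside_of_continuous
      (T.continuous_extension (Pi.single i 1))).const_mul (k * w i)
    have i₂ : IntegrableOn (fun p => k * (T.extension (fun j => w i - w j) p *
        T.extension (Pi.single i 1) p)) T.inside := (T.integrableOn_inside_of_continuous
      ((T.continuous_extension fun j => w i - w j).mul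
        (T.continuous_extension (Pi.single i 1)))).const_mul k
    rw [cT, ← integral_const_mul, ← integral_const_mul, ← integral_sub i₁ i₂]
    refine setIntegral_congr_fun T.measurableSet_inside fun p hp => ?_
    rw [hc p hp, T.extension_eq_add_sub w (w i) p]
    ring
  have b : ‖∫ p in T.inside,
      T.extension (fun j => w i - w j) p * T.extension (Pi.single i 1) p‖
      ≤ (∑ j, (w i - w j)) * volume.real T.inside := by
    apply norm_setIntegral_le_of_norm_le_const T.volume_inside_lt_top
    intro p hp
    have hs := T.abs_extension_le (fun j => w i - w j) hp
    simp only [abs_of_nonneg (sub_nonneg.2 (hw _))] at hs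
    rw [norm_mul, ← mul_one (∑ j, _)]
    exact mul_le_mul hs (T.abs_extension_single_le i hp) (norm_nonneg _)
      ((abs_nonneg _).trans hs)
  rw [T.measureReal_inside] at b
  have b' := mul_le_mul_of_nonneg_left ((le_abs_self _).trans b) hk
  have n := mul_nonneg hkw (T.integral_extension_single_nonneg i)
  rw [e]
  nlinarith

/-- The contribution of one element to the bilinear form. -/
noncomputable def localForm (h κ : ℝ) (α : ℝ × ℝ → ℝ) (β : ℝ × ℝ → EuclideanSpace ℝ (Fin 2))
    (c : ℝ × ℝ → ℝ) (T : Rect) (u v : Fin 4 → ℝ) : ℝ :=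
  κ * stabT h T u v + (aT α T u v + bT β T u v + cT c T u v)

/-- The scalar core: `r₁`, `r₂` are the lower-order losses, leaving coefficients at least `11 L /
12` for `d` and `s / 2` for `e₁ + e₂`. When `κ = 0` the former is still at least `J > 0`. -/
theorem nonneg_and_eq_zero_of_le {κ s L F J d e₁ e₂ r₁ r₂ : ℝ} (hL : 0 ≤ L) (hs : 0 ≤ s)
    (hκ0 : κ = 0 → s = 0 ∧ L = 0) (hκ : 0 < κ → 0 < s) (hJ : s + L ≤ J) (hJ0 : 0 < J)
    (hd : 0 ≤ d) (he₁ : 0 ≤ e₁) (he₂ : 0 ≤ e₂) (hr₁ : r₁ ≤ L / 12) (hr₂ : r₂ ≤ s / 2)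
    (hF : (J - s - r₁) * d + (s - r₂) * (e₁ + e₂) ≤ F) :
    0 ≤ F ∧ (F ≤ 0 → (κ = 0 → d = 0) ∧ (0 < κ → e₁ = 0 ∧ e₂ = 0)) := by
  have m₁ : 0 ≤ (J - s - r₁) * d := mul_nonneg (by linarith) hd
  have m₂ : s / 2 * (e₁ + e₂) ≤ (s - r₂) * (e₁ + e₂) :=
    mul_le_mul_of_nonneg_right (by linarith) (by linarith)
  have m₃ : 0 ≤ s / 2 * (e₁ + e₂) := mul_nonneg (by linarith) (by linarith)
  refine ⟨by linarith, fun hF0 => ⟨fun h0 => ?_, fun hpos => ?_⟩⟩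
  · obtain ⟨s0, l0⟩ := hκ0 h0
    have z : (J - s - r₁) * d = 0 := by linarith
    exact (mul_eq_zero.1 z).resolve_left (by linarith)
  · have z : s / 2 * (e₁ + e₂) = 0 := by linarith
    have := (mul_eq_zero.1 z).resolve_left (half_pos (hκ hpos)).ne'
    exact ⟨by linarith, by linarith⟩

/-- The strong maximum principle on one element, tested with the basis function of an edge at which
the edge values are maximal. -/
theorem localForm_single {h κ B k α₀ : ℝ} {α : ℝ × ℝ → ℝ}
    {β : ℝ × ℝ → EuclideanSpace ℝ (Fin 2)} {c : ℝ × ℝ → ℝ} {T : Rect}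
    (hT : T.diam ≤ h) (hκ : 0 ≤ κ) (hα₀ : 0 < α₀) (hα : ∀ p ∈ T.inside, α₀ ≤ α p)
    (hαi : IntegrableOn α T.inside) (hB : 0 ≤ B)
    (hβ : ∀ᵐ p ∂volume.restrict T.inside, ‖β p‖ ≤ B)
    (hk : 0 ≤ k) (hc : ∀ p ∈ T.inside, c p = k)
    (hcond : ∀ p ∈ T.inside, 12 * B * h + 12 * k * h ^ 2 ≤
      min (α p * T.aspect - κ * T.hx / (2 * h * (1 + T.aspect)))
        (α p * T.aspect⁻¹ - κ * T.hx / (2 * h * (1 + T.aspect))))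
    (hκL : 12 * B * h + 12 * k * h ^ 2 ≤ κ) (hσ : T.aspect ∈ Icc (1 / 2 : ℝ) 2)
    {w : Fin 4 → ℝ} {i : Fin 4} (hw : ∀ j, w j ≤ w i) (hkw : 0 ≤ k * w i) :
    0 ≤ localForm h κ α β c T w (Pi.single i 1) ∧
      (localForm h κ α β c T w (Pi.single i 1) ≤ 0 →
        (κ = 0 → w (Rect.opp i) = w i) ∧ (0 < κ → ∀ j, j ≠ Rect.opp i → w j = w i)) := by
  have ha := T.hx_pos
  have hb := T.hy_pos
  have hah : T.hx ≤ h := T.hx_le_diam.trans hT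
  have hbh : T.hy ≤ h := T.hy_le_diam.trans hT
  have hh : 0 < h := ha.trans_le hah
  have hab : T.hx ≤ 2 * T.hy := (div_le_iff₀ hb).1 hσ.2
  have hba : 1 / 2 * T.hy ≤ T.hx := (le_div_iff₀ hb).1 hσ.1
  set L := 12 * B * h + 12 * k * h ^ 2 with hL
  have hL0 : 0 ≤ L := by positivity
  set s := κ * (h⁻¹ * (T.area / (2 * (T.hx + T.hy)))) with hs
  have hs' : κ * T.hx / (2 * h * (1 + T.aspect)) = s := by
    rw [hs, Rect.aspect, Rect.area]; field_simp; ring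
  rw [hs'] at hcond
  set I := ∫ p in T.inside, α p with hI
  have lower : ∀ m : ℝ, (∀ p ∈ T.inside, m ≤ α p) → m * T.area ≤ I := fun m hm => by
    have := setIntegral_mono_on (μ := volume) (f := fun _ => m) (g := α)
      (integrableOn_const T.volume_inside_lt_top.ne) hαi T.measurableSet_inside hm
    rwa [setIntegral_const, T.measureReal_inside, smul_eq_mul, mul_comm] at this
  have hI0 : 0 < I := (mul_pos hα₀ T.area_pos).trans_le (lower _ hα)
  -- The pointwise condition is integrated, using `σ |T| = h_x²` here and `|T| / σ = h_y²` below.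
  have hIx : s + L ≤ I / T.hx ^ 2 := by
    rw [le_div_iff₀ (by positivity)]
    refine le_trans (le_of_eq ?_) (lower ((s + L) * T.aspect) fun p hp => ?_)
    · rw [Rect.area, Rect.aspect]; field_simp
    · have := (hcond p hp).trans (min_le_right _ _)
      rw [← div_eq_mul_inv] at this
      exact (le_div_iff₀ T.aspect_pos).1 (by linarith)
  have hIy : s + L ≤ I / T.hy ^ 2 := by
    rw [le_div_iff₀ (by positivity)]
    refine le_trans (le_of_eq ?_) (lower ((s + L) / T.aspect) fun p hp => ?_)
    · rw [Rect.area, Rect.aspect]; field_simp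
    · have := (hcond p hp).trans (min_le_left _ _)
      exact (div_le_iff₀ T.aspect_pos).2 (by linarith)
  have hIx0 : 0 < I / T.hx ^ 2 := by positivity
  have hIy0 : 0 < I / T.hy ^ 2 := by positivity
  have hs0 : 0 ≤ s := mul_nonneg hκ (by have := T.area_pos; positivity)
  have hspos : 0 < κ → 0 < s := fun h' => mul_pos h' (by have := T.area_pos; positivity)
  have area_le : T.area ≤ h ^ 2 := by rw [Rect.area]; nlinarith
  -- the lower-order terms are dominated by `L / 12` and by `s / 2`
  have small₁ : ∀ t, t ≤ h → B * t + k * T.area ≤ L / 12 := fun t ht => by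
    have := mul_le_mul_of_nonneg_left ht hB
    have := mul_le_mul_of_nonneg_left area_le hk
    linarith
  have s_lower : ∀ t, (t = T.hx ∨ t = T.hy) → κ * t / (6 * h) ≤ s := fun t ht => by
    have e : s = κ * (T.hx * T.hy) / (2 * h * (T.hx + T.hy)) := by
      rw [hs, Rect.area]; field_simp
    rw [e, div_le_div_iff₀ (by positivity) (by positivity)]
    -- The bounds on `σ` give `h_x + h_y ≤ 3 h_y` and `h_x + h_y ≤ 3 h_x`.
    have : t * (T.hx + T.hy) ≤ 3 * (T.hx * T.hy) := by
      rcases ht with rfl | rfl <;> nlinarith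
    have := mul_le_mul_of_nonneg_left this (by positivity : 0 ≤ 2 * h * κ)
    linarith
  have small₂ : ∀ t, (t = T.hx ∨ t = T.hy) → B * t + k * T.area ≤ s / 2 := fun t ht => by
    have ht0 : 0 ≤ t := by rcases ht with rfl | rfl <;> positivity
    have h₁ : T.area ≤ t * h := by
      rw [Rect.area]; rcases ht with rfl | rfl <;> nlinarith
    -- This is `L ≤ κ` divided by `12 h`.
    have h₂ : B + k * h ≤ κ / (12 * h) := by
      rw [le_div_iff₀ (by positivity)]; linarith
    have h₃ : κ * t / (6 * h) = 2 * (κ / (12 * h) * t) := by field_simp; ring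
    have := s_lower t ht
    have := mul_le_mul_of_nonneg_right h₂ ht0
    have := mul_le_mul_of_nonneg_left h₁ hk
    linarith
  have hκ0 : κ = 0 → s = 0 ∧ L = 0 := fun h0 => ⟨by rw [hs, h0, zero_mul], by linarith⟩
  have conclude : ∀ {F J d e₁ e₂ t₁ t₂ : ℝ}, s + L ≤ J → 0 < J → 0 ≤ d → 0 ≤ e₁ → 0 ≤ e₂ →
      t₁ ≤ h → (t₂ = T.hx ∨ t₂ = T.hy) →
      (J - s - (B * t₁ + k * T.area)) * d + (s - (B * t₂ + k * T.area)) * (e₁ + e₂) ≤ F →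
      0 ≤ F ∧ (F ≤ 0 → (κ = 0 → d = 0) ∧ (0 < κ → e₁ = 0 ∧ e₂ = 0)) :=
    fun hJ hJ0 hd he₁ he₂ ht₁ ht₂ hF => nonneg_and_eq_zero_of_le hL0 hs0 hκ0 hspos hJ hJ0 hd he₁
      he₂ (small₁ _ ht₁) (small₂ _ ht₂) hF
  have hb' := (abs_le.1 (abs_bT_single_le hβ w i)).1
  have hc' := neg_le_cT_single hc hk hw hkw
  have hF : localForm h κ α β c T w (Pi.single i 1) = s * ((w 2 + w 3 - w 0 - w 1) *
        ((Pi.single i 1 : Fin 4 → ℝ) 2 + (Pi.single i 1 : Fin 4 → ℝ) 3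
          - (Pi.single i 1 : Fin 4 → ℝ) 0 - (Pi.single i 1 : Fin 4 → ℝ) 1)) +
      (I / T.hx ^ 2 * ((w 1 - w 0) * ((Pi.single i 1 : Fin 4 → ℝ) 1 - (Pi.single i 1 : Fin 4 → ℝ) 0))
        + I / T.hy ^ 2 *
          ((w 3 - w 2) * ((Pi.single i 1 : Fin 4 → ℝ) 3 - (Pi.single i 1 : Fin 4 → ℝ) 2)) +
        bT β T w (Pi.single i 1) + cT c T w (Pi.single i 1)) := by
    rw [localForm, stabT_eq, aT_eq, ← hI, hs]
    ring
  set F := localForm h κ α β c T w (Pi.single i 1)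
  set b := bT β T w (Pi.single i 1)
  set γ := cT c T w (Pi.single i 1)
  clear_value F b γ s I
  rw [Fin.sum_univ_four] at hc'
  -- `|w j - w j'|` is at most the sum of the two deficits
  have gap : ∀ j j', |w j - w j'| ≤ (w i - w j) + (w i - w j') := fun j j' =>
    abs_le.2 ⟨by linarith [hw j, hw j'], by linarith [hw j, hw j']⟩
  have g01 := mul_le_mul_of_nonneg_left (gap 1 0) (mul_nonneg hB hb.le)
  have g23 := mul_le_mul_of_nonneg_left (gap 3 2) (mul_nonneg hB ha.le)
  have w0 := hw 0
  have w1 := hw 1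
  have w2 := hw 2
  have w3 := hw 3
  have four : ∀ {p : Fin 4 → Prop}, p 0 → p 1 → p 2 → p 3 → ∀ j, p j := fun h0 h1 h2 h3 j => by
    fin_cases j <;> assumption
  fin_cases i <;> simp at hF hc' w0 w1 w2 w3 g01 g23 <;> simp [Rect.opp]
  -- For a vertical edge the convection loss is `B h_y` on `d` and `B h_x` on `e₁ + e₂`; for a
  -- horizontal edge the roles are exchanged.
  · obtain ⟨p, q⟩ := conclude hIx hIx0 (sub_nonneg.2 w1) (sub_nonneg.2 w2) (sub_nonneg.2 w3)
      hbh (.inl rfl) (F := F) (by rw [hF]; linarith)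
    refine ⟨p, fun h' => ⟨fun h0 => by linarith [(q h').1 h0], fun h0 => ?_⟩⟩
    have := (q h').2 h0
    exact four (fun _ => rfl) (fun hj => absurd rfl hj) (fun _ => by linarith) fun _ => by linarith
  · obtain ⟨p, q⟩ := conclude hIx hIx0 (sub_nonneg.2 w0) (sub_nonneg.2 w2) (sub_nonneg.2 w3)
      hbh (.inl rfl) (F := F) (by rw [hF]; linarith)
    refine ⟨p, fun h' => ⟨fun h0 => by linarith [(q h').1 h0], fun h0 => ?_⟩⟩
    have := (q h').2 h0
    exact four (fun hj => absurd rfl hj) (fun _ => rfl) (fun _ => by linarith) fun _ => by linarith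
  · obtain ⟨p, q⟩ := conclude hIy hIy0 (sub_nonneg.2 w3) (sub_nonneg.2 w0) (sub_nonneg.2 w1)
      hah (.inr rfl) (F := F) (by rw [hF]; linarith)
    refine ⟨p, fun h' => ⟨fun h0 => by linarith [(q h').1 h0], fun h0 => ?_⟩⟩
    have := (q h').2 h0
    exact four (fun _ => by linarith) (fun _ => by linarith) (fun _ => rfl) fun hj => absurd rfl hj
  · obtain ⟨p, q⟩ := conclude hIy hIy0 (sub_nonneg.2 w2) (sub_nonneg.2 w0) (sub_nonneg.2 w1)
      hah (.inr rfl) (F := F) (by rw [hF]; linarith)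
    refine ⟨p, fun h' => ⟨fun h0 => by linarith [(q h').1 h0], fun h0 => ?_⟩⟩
    have := (q h').2 h0
    exact four (fun _ => by linarith) (fun _ => by linarith) (fun hj => absurd rfl hj) fun _ => rfl

/-- The center weights `2 - σ` and `2σ - 1` are both nonnegative exactly when `σ ∈ [1/2, 2]`. -/
theorem loadT_single_nonpos {f : ℝ × ℝ → ℝ} {T : Rect} (hσ : T.aspect ∈ Icc (1 / 2 : ℝ) 2)
    (hf : f T.center ≤ 0) {i : Fin 4} (hfi : f (T.edge i).midpoint ≤ 0) :
    loadT f T (Pi.single i 1) ≤ 0 := by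
  have h1 : 0 ≤ T.area / 6 := by have := T.area_pos; positivity
  have h2 : 0 ≤ T.area / (6 * (1 + T.aspect)) := by
    have := T.area_pos; have := T.aspect_pos; positivity
  have h3 : ∑ j, f (T.edge j).midpoint * (Pi.single i 1 : Fin 4 → ℝ) j
      = f (T.edge i).midpoint := by
    simp [Pi.single_apply]
  rw [loadT, h3]
  refine add_nonpos (mul_nonpos_of_nonneg_of_nonpos h1 hfi)
    (mul_nonpos_of_nonpos_of_nonneg (mul_nonpos_of_nonneg_of_nonpos h2 hf) ?_)
  obtain ⟨l, r⟩ := hσ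
  fin_cases i <;> simp <;> linarith

/-! ### The domain and essential bounds of the coefficients -/

variable {M : RectMesh}

theorem diam_le_meshSize {T : Rect} (hT : T ∈ M.elems) : T.diam ≤ M.meshSize :=
  Finset.le_sup' Rect.diam hT

theorem toSet_subset_iUnion {T : Rect} (hT : T ∈ M.elems) :
    T.toSet ⊆ ⋃ T ∈ M.elems, T.toSet :=
  subset_biUnion_of_mem (u := fun T : Rect => T.toSet) hT

theorem inside_subset_domain {T : Rect} (hT : T ∈ M.elems) : T.inside ⊆ M.domain :=
  interior_maximal (T.inside_subset_toSet.trans (toSet_subset_iUnion hT)) T.isOpen_inside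

theorem toSet_subset_closure_domain {T : Rect} (hT : T ∈ M.elems) :
    T.toSet ⊆ closure M.domain := by
  rw [← T.closure_inside]
  exact closure_mono (inside_subset_domain hT)

theorem midpoint_mem_domain {e : M.Edge} (he : ¬ IsBoundaryEdge e) : e.1.midpoint ∈ M.domain := by
  obtain ⟨T, hT, i, hi⟩ := e.2
  have h : e.1.midpoint ∈ closure M.domain :=
    toSet_subset_closure_domain hT (hi ▸ T.midpoint_edge_mem_toSet i)
  by_contra hn
  exact he ⟨h, fun h' => hn (interior_subset h')⟩

/-- The values of `c` on the mesh edges are arbitrary, but these form a null set. Finiteness keeps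
`toReal` in `normInf` from collapsing to zero. -/
theorem isBounded_piecewise {c : ℝ × ℝ → ℝ} (hc : M.PiecewiseConst c) :
    eLpNorm c ∞ (volume.restrict M.domain) < ∞ := by
  choose! k hk using hc
  have hae : ∀ᵐ p ∂volume, ∀ T ∈ M.elems, (p ∈ T.inside) = (p ∈ T.toSet) :=
    (ae_ball_iff M.elems.countable_toSet).2 fun T _ => T.inside_ae_eq_toSet
  refine eLpNormEssSup_lt_top_of_ae_bound (C := ∑ T ∈ M.elems, |k T|) ?_
  filter_upwards [ae_restrict_of_ae hae,
    ae_restrict_mem (isOpen_interior : IsOpen M.domain).measurableSet] with p hp hpd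
  obtain ⟨T, hT, hpT⟩ := mem_iUnion₂.1 (interior_subset hpd)
  rw [hk T hT p (by rw [hp T hT]; exact hpT)]
  exact Finset.single_le_sum (f := fun T => |k T|) (fun _ _ => abs_nonneg _) hT

theorem ae_norm_le_normInf {E : Type*} [NormedAddCommGroup E] {φ : ℝ × ℝ → E}
    (hφ : eLpNorm φ ∞ (volume.restrict M.domain) < ∞) {T : Rect} (hT : T ∈ M.elems) :
    ∀ᵐ p ∂volume.restrict T.inside, ‖φ p‖ ≤ M.normInf φ := by
  refine ae_restrict_of_ae_restrict_of_subset (inside_subset_domain hT) ?_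
  rw [eLpNorm_exponent_top] at hφ
  filter_upwards [ae_le_eLpNormEssSup (f := φ) (μ := volume.restrict M.domain)] with p hp
  rw [normInf, eLpNorm_exponent_top, ← toReal_enorm]
  exact ENNReal.toReal_mono hφ.ne hp

theorem abs_const_le_normInf {c : ℝ × ℝ → ℝ} (hc : M.PiecewiseConst c) {T : Rect}
    (hT : T ∈ M.elems) {k : ℝ} (hk : ∀ p ∈ T.inside, c p = k) : |k| ≤ M.normInf c := by
  have h := ae_norm_le_normInf (isBounded_piecewise hc) hT
  have : (ae (volume.restrict T.inside)).NeBot := by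
    rw [ae_neBot, Ne, Measure.restrict_eq_zero, T.volume_inside]
    simpa using T.area_pos
  obtain ⟨p, hp, hpT⟩ := (h.and (ae_restrict_mem T.measurableSet_inside)).exists
  rwa [hk p hpT] at hp

/-! ### Conformity and the search for a boundary edge -/

/-- If the points `γ t`, for small `t > 0`, lie in the union of the elements, then
one single element contains points `γ t` for arbitrarily small `t > 0`, and the limit point. -/
theorem exists_elem_frequently {γ : ℝ → ℝ × ℝ} (hγ : Continuous γ) (h0 : γ 0 ∈ M.domain) :
    ∃ T ∈ M.elems, γ 0 ∈ T.toSet ∧ ∃ t > 0, γ t ∈ T.toSet := by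
  have hev : ∀ᶠ t in nhdsWithin (0 : ℝ) (Ioi 0), ∃ T ∈ M.elems, γ t ∈ T.toSet := by
    have := hγ.continuousAt.eventually_mem ((isOpen_interior : IsOpen M.domain).mem_nhds h0)
    filter_upwards [nhdsWithin_le_nhds this] with t ht
    simpa using interior_subset ht
  -- Pigeonhole: the elements are finitely many. Closedness of the chosen one then captures the
  -- limit point.
  obtain ⟨T, hT, hfr⟩ : ∃ T ∈ M.elems, ∃ᶠ t in nhdsWithin (0 : ℝ) (Ioi 0), γ t ∈ T.toSet := by
    by_contra! hcon
    have : ∀ᶠ t in nhdsWithin (0 : ℝ) (Ioi 0), ∀ T ∈ M.elems, γ t ∉ T.toSet :=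
      (Filter.eventually_all_finset _).2 fun T hT => hcon T hT
    obtain ⟨t, ⟨T, hT, h1⟩, h2⟩ := (hev.and this).exists
    exact h2 T hT h1
  refine ⟨T, hT, ?_, ?_⟩
  · by_contra hn
    have := hγ.continuousAt.eventually_mem (T.isClosed_toSet.isOpen_compl.mem_nhds hn)
    exact hfr (nhdsWithin_le_nhds this)
  · obtain ⟨t, ht, hpos⟩ := (hfr.and_eventually self_mem_nhdsWithin).exists
    exact ⟨t, hpos, ht⟩

/-- An element containing the midpoint of an edge of another element has this edge in common
with it. -/
theorem exists_edge_eq {T T' : Rect} (hT : T ∈ M.elems) (hT' : T' ∈ M.elems) {i : Fin 4}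
    (h : (T.edge i).midpoint ∈ T'.toSet) : ∃ j, T'.edge j = T.edge i := by
  by_cases hTT : T = T'
  · exact ⟨i, by rw [hTT]⟩
  have hx := T.hx_lt
  have hy := T.hy_lt
  have hm : (T.edge i).midpoint ∈ T.toSet ∩ T'.toSet := ⟨T.midpoint_edge_mem_toSet i, h⟩
  -- A midpoint is not a vertex, and the only edge of `T` through it is the edge `i`.
  rcases M.conforming T hT T' hT' hTT with h0 | ⟨p, hp, hpe⟩ | ⟨i', j, hij, he⟩
  · rw [h0] at hm; exact hm.elim
  · rw [hpe, mem_singleton_iff] at hm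
    have hv := hp.1
    rw [← hm] at hv
    exfalso
    fin_cases i <;> simp [Rect.edge, Seg.midpoint, Rect.vertices] at hv <;> grind
  · rw [he] at hm
    have : i' = i := by
      fin_cases i <;> fin_cases i' <;>
        simp [Rect.edge, Seg.midpoint, Seg.toSet] at hm ⊢ <;> grind
    exact ⟨j, by rw [← hij, this]⟩

/-- The midpoint is interior to `Ω`, so some element contains both it and a point to its right. By
conformity the edge belongs to that element, and it cannot be the right edge. -/
theorem exists_left_of_vert {x y₀ y₁ : ℝ} (e : M.Edge) (he : e.1 = .vert x y₀ y₁)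
    (hb : ¬ IsBoundaryEdge e) : ∃ T ∈ M.elems, T.edge 0 = e.1 := by
  obtain ⟨T, hT, i, hi⟩ := e.2
  have hd := midpoint_mem_domain hb
  obtain ⟨T', hT', h0, t, ht, htT⟩ :=
    exists_elem_frequently (γ := fun t => ((Seg.midpoint e.1).1 + t, (Seg.midpoint e.1).2))
      (by fun_prop) (by simpa using hd)
  rw [add_zero, Prod.mk.eta, ← hi] at h0
  obtain ⟨j, hj⟩ := exists_edge_eq hT hT' h0
  rw [hi] at hj
  refine ⟨T', hT', ?_⟩
  have hle := htT.1.2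
  rw [he] at hj hle ⊢
  simp only [Seg.midpoint] at hle
  fin_cases j <;> simp [Rect.edge] at hj ⊢
  · exact hj
  · linarith

theorem exists_bottom_of_horiz {y x₀ x₁ : ℝ} (e : M.Edge) (he : e.1 = .horiz y x₀ x₁)
    (hb : ¬ IsBoundaryEdge e) : ∃ T ∈ M.elems, T.edge 2 = e.1 := by
  obtain ⟨T, hT, i, hi⟩ := e.2
  have hd := midpoint_mem_domain hb
  obtain ⟨T', hT', h0, t, ht, htT⟩ :=
    exists_elem_frequently (γ := fun t => ((Seg.midpoint e.1).1, (Seg.midpoint e.1).2 + t))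
      (by fun_prop) (by simpa using hd)
  rw [add_zero, Prod.mk.eta, ← hi] at h0
  obtain ⟨j, hj⟩ := exists_edge_eq hT hT' h0
  rw [hi] at hj
  refine ⟨T', hT', ?_⟩
  have hle := htT.2.2
  rw [he] at hj hle ⊢
  simp only [Seg.midpoint] at hle
  fin_cases j <;> simp [Rect.edge] at hj ⊢
  · exact hj
  · linarith

instance : Finite M.Edge := by
  have : (⋃ T ∈ M.elems, range T.edge).Finite :=
    M.elems.finite_toSet.biUnion fun T _ => finite_range _
  have h : {e | ∃ T ∈ M.elems, ∃ i, T.edge i = e}.Finite := by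
    refine this.subset fun e he => ?_
    obtain ⟨T, hT, i, hi⟩ := he
    exact mem_biUnion (s := (M.elems : Set Rect)) hT ⟨i, hi⟩
  exact h.to_subtype

/-- An edge of an element, as an edge of the mesh. -/
def Edge.of {T : Rect} (hT : T ∈ M.elems) (i : Fin 4) : M.Edge := ⟨T.edge i, T, hT, i, rfl⟩

instance : Nonempty M.Edge := by
  obtain ⟨T, hT⟩ := M.elems_nonempty
  exact ⟨Edge.of hT 0⟩

/-- A nonempty set of edges that contains a boundary edge, or with an edge also the opposite edge
in each element, contains a boundary edge: take a rightmost vertical or a topmost horizontal one. -/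
theorem exists_isBoundaryEdge {P : M.Edge → Prop} (hne : ∃ e, P e)
    (hP : (∀ e, P e → ¬ IsBoundaryEdge e) → ∀ {T : Rect} (hT : T ∈ M.elems) (i : Fin 4),
      P (Edge.of hT i) → P (Edge.of hT (Rect.opp i))) :
    ∃ e, P e ∧ IsBoundaryEdge e := by
  by_contra! hnb
  replace hP := @hP hnb
  obtain ⟨⟨e, he'⟩, he⟩ := hne
  rcases e with ⟨x, y₀, y₁⟩ | ⟨y, x₀, x₁⟩
  · obtain ⟨m, ⟨hm, x', z₀, z₁, hm'⟩, hmax⟩ := Set.exists_max_image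
      {e : M.Edge | P e ∧ ∃ x y₀ y₁, e.1 = .vert x y₀ y₁} (fun e => e.1.midpoint.1)
      (toFinite _) ⟨⟨.vert x y₀ y₁, he'⟩, he, _, _, _, rfl⟩
    -- The rightmost edge `m` is the left edge of `T`, whose right edge also satisfies `P` and lies
    -- strictly further right.
    obtain ⟨T, hT, h0⟩ := exists_left_of_vert m hm' (hnb m hm)
    have h1 : Edge.of hT 0 = m := Subtype.ext h0
    have := hmax (Edge.of hT 1) ⟨hP hT 0 (h1 ▸ hm), _, _, _, rfl⟩
    rw [← h1] at this
    exact absurd this (not_le.2 T.hx_lt)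
  · obtain ⟨m, ⟨hm, x', z₀, z₁, hm'⟩, hmax⟩ := Set.exists_max_image
      {e : M.Edge | P e ∧ ∃ x y₀ y₁, e.1 = .horiz x y₀ y₁} (fun e => e.1.midpoint.2)
      (toFinite _) ⟨⟨.horiz y x₀ x₁, he'⟩, he, _, _, _, rfl⟩
    obtain ⟨T, hT, h0⟩ := exists_bottom_of_horiz m hm' (hnb m hm)
    have h1 : Edge.of hT 2 = m := Subtype.ext h0
    have := hmax (Edge.of hT 3) ⟨hP hT 2 (h1 ▸ hm), _, _, _, rfl⟩
    rw [← h1] at this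
    exact absurd this (not_le.2 T.hy_lt)

/-! ### Assembly of the elements and the global maximum principle -/

theorem formA_eq_sum (κ : ℝ) (α : ℝ × ℝ → ℝ) (β : ℝ × ℝ → EuclideanSpace ℝ (Fin 2))
    (c : ℝ × ℝ → ℝ) (u v : M.EdgeFun) :
    formA κ α β c u v = ∑ T : {T // T ∈ M.elems},
      localForm M.meshSize κ α β c T.1 (u.loc T) (v.loc T) := by
  simp only [formA, localForm, Finset.mul_sum, Finset.sum_add_distrib]

open Classical in
theorem loc_single_eq_single {T : {T // T ∈ M.elems}} {e : M.Edge} {i : Fin 4}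
    (h : T.1.edge i = e.1) : EdgeFun.loc (Pi.single e 1 : M.EdgeFun) T = Pi.single i 1 := by
  funext j
  change (Pi.single e 1 : M.Edge → ℝ) (Edge.of T.2 j) = _
  rw [Pi.single_apply, Pi.single_apply]
  refine if_congr (Subtype.ext_iff.trans ?_) rfl rfl
  rw [← h]
  exact T.1.edge_injective.eq_iff

open Classical in
theorem loc_single_eq_zero {T : {T // T ∈ M.elems}} {e : M.Edge}
    (h : ∀ i, T.1.edge i ≠ e.1) : EdgeFun.loc (Pi.single e 1 : M.EdgeFun) T = 0 := by
  funext j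
  exact Pi.single_eq_of_ne (M := fun _ : M.Edge => ℝ) (i' := Edge.of T.2 j)
    (fun h' => h j (Subtype.ext_iff.1 h')) 1

theorem localForm_zero_right (h κ : ℝ) (α : ℝ × ℝ → ℝ)
    (β : ℝ × ℝ → EuclideanSpace ℝ (Fin 2)) (c : ℝ × ℝ → ℝ) (T : Rect) (u : Fin 4 → ℝ) :
    localForm h κ α β c T u 0 = 0 := by
  simp [localForm, stabT_eq, aT_eq, bT, cT, Rect.extension]

theorem loadT_zero (f : ℝ × ℝ → ℝ) (T : Rect) : loadT f T 0 = 0 := by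
  simp [loadT]

/-- The strong discrete maximum principle: a maximal value `K` with `c K ≥ 0` is attained on the
boundary. -/
theorem exists_boundary_max {κ α₀ : ℝ} {α : ℝ × ℝ → ℝ} {β : ℝ × ℝ → EuclideanSpace ℝ (Fin 2)}
    {c f g : ℝ × ℝ → ℝ} {u : M.EdgeFun} (hκ : 0 ≤ κ) (hα₀ : 0 < α₀)
    (hα : ∀ p ∈ M.domain, α₀ ≤ α p) (hαi : IntegrableOn α M.domain)
    (hβ : MemLp β ∞ (volume.restrict M.domain)) (hc : M.PiecewiseConst c)
    (hcond : M.KappaCond 12 12 κ α β c) (hκL : M.lowerOrder 12 12 β c ≤ κ)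
    (hσ : ∀ T ∈ M.elems, T.aspect ∈ Icc (1 / 2 : ℝ) 2) (hf : ∀ p ∈ M.domain, f p ≤ 0)
    (hu : IsSWGSolution κ α β c f g u) (hc0 : ∀ p ∈ M.domain, 0 ≤ c p)
    {K : ℝ} (hK : IsGreatest (range u) K) (hcK : ∀ p ∈ M.domain, 0 ≤ c p * K) :
    ∃ e, u e = K ∧ IsBoundaryEdge e := by
  classical
  have hB : 0 ≤ M.normInf β := ENNReal.toReal_nonneg
  have loc : ∀ (T : {T // T ∈ M.elems}) (i : Fin 4), u.loc T i = K →
      0 ≤ localForm M.meshSize κ α β c T.1 (u.loc T) (Pi.single i 1) ∧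
      (localForm M.meshSize κ α β c T.1 (u.loc T) (Pi.single i 1) ≤ 0 →
        (κ = 0 → u.loc T (Rect.opp i) = K) ∧
          (0 < κ → ∀ j, j ≠ Rect.opp i → u.loc T j = K)) := by
    rintro ⟨T, hT⟩ i hi
    obtain ⟨k, hk⟩ := hc T hT
    have hcen := inside_subset_domain hT T.center_mem_inside
    have hk' := hk _ T.center_mem_inside
    have hk0 : 0 ≤ k := hk' ▸ hc0 _ hcen
    have hkn : k ≤ M.normInf c := (le_abs_self k).trans (abs_const_le_normInf hc hT hk)
    have hL : 12 * M.normInf β * M.meshSize + 12 * k * M.meshSize ^ 2 ≤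
        M.lowerOrder 12 12 β c := by
      rw [lowerOrder]
      gcongr
    rw [← hi]
    exact localForm_single (diam_le_meshSize hT) hκ hα₀
      (fun p hp => hα p (inside_subset_domain hT hp)) (hαi.mono_set (inside_subset_domain hT)) hB
      (ae_norm_le_normInf hβ.2 hT) hk0 hk (fun p hp => hL.trans (hcond T hT p hp))
      (hL.trans hκL) (hσ T hT) (fun j => hi ▸ hK.2 ⟨_, rfl⟩)
      (by rw [hi, ← hk']; exact hcK _ hcen)
  have step : ∀ (T : {T // T ∈ M.elems}) (i : Fin 4), u.loc T i = K →
      ¬ IsBoundaryEdge (Edge.of T.2 i) →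
      localForm M.meshSize κ α β c T.1 (u.loc T) (Pi.single i 1) ≤ 0 := by
    intro T i hi hnb
    set e := Edge.of T.2 i
    have hz : ∀ e', IsBoundaryEdge e' → (Pi.single e 1 : M.EdgeFun) e' = 0 := fun e' he' =>
      Pi.single_eq_of_ne (M := fun _ : M.Edge => ℝ) (fun h : e' = e => hnb (h ▸ he')) 1
    have heq := hu.2 (Pi.single e 1) hz
    rw [formA_eq_sum] at heq
    have load : ∑ T : {T // T ∈ M.elems}, loadT f T.1 (EdgeFun.loc (Pi.single e 1) T) ≤ 0 := by
      refine Finset.sum_nonpos fun S _ => ?_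
      by_cases hS : ∃ j, S.1.edge j = e.1
      · obtain ⟨j, hj⟩ := hS
        rw [loc_single_eq_single hj]
        exact loadT_single_nonpos (hσ S.1 S.2)
          (hf _ (inside_subset_domain S.2 S.1.center_mem_inside))
          (hf _ (hj ▸ midpoint_mem_domain hnb))
      · rw [loc_single_eq_zero (not_exists.1 hS), loadT_zero]
    have nonneg : ∀ S : {T // T ∈ M.elems}, 0 ≤ localForm M.meshSize κ α β c S.1 (u.loc S)
        (EdgeFun.loc (Pi.single e 1) S) := by
      intro S
      by_cases hS : ∃ j, S.1.edge j = e.1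
      · obtain ⟨j, hj⟩ := hS
        rw [loc_single_eq_single hj]
        refine (loc S j ?_).1
        rw [← hi]
        exact congrArg u (Subtype.ext hj)
      · rw [loc_single_eq_zero (not_exists.1 hS), localForm_zero_right]
    -- A single nonnegative term is at most the whole sum, which equals the nonpositive load.
    have := Finset.single_le_sum (fun S _ => nonneg S) (Finset.mem_univ T)
    rw [loc_single_eq_single (i := i) rfl] at this
    linarith
  refine exists_isBoundaryEdge hK.1 fun hnb T hT i hi => ?_
  have prop : ∀ j, u.loc ⟨T, hT⟩ j = K → _ := fun j hj =>
    (loc ⟨T, hT⟩ j hj).2 (step ⟨T, hT⟩ j hj (hnb (Edge.of hT j) hj))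
  rcases hκ.eq_or_lt' with h0 | hpos
  · exact (prop i hi).1 h0
  · have tr : ∀ j, u.loc ⟨T, hT⟩ j = K → ∀ l, l ≠ Rect.opp j → u.loc ⟨T, hT⟩ l = K :=
      fun j hj => (prop j hj).2 hpos
    -- For `κ > 0` equality reaches only adjacent edges, so the opposite edge is reached through an
    -- edge `j` adjacent to both.
    have : ∃ j, j ≠ Rect.opp i ∧ Rect.opp i ≠ Rect.opp j := by clear hi; revert i; decide
    obtain ⟨j, h1, h2⟩ := this
    exact tr j (tr i hi j h1) _ h2

end RectMesh

end SWG

open SWG in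
theorem theorem3p1 :
    ∃ C₀ C₁ : ℝ, 0 < C₀ ∧ 0 < C₁ ∧
      ∀ (M : RectMesh) (κ α₀ : ℝ) (α : ℝ × ℝ → ℝ) (β : ℝ × ℝ → EuclideanSpace ℝ (Fin 2))
        (c f g : ℝ × ℝ → ℝ) (u : M.EdgeFun),
        0 ≤ κ →
        0 < α₀ → (∀ p ∈ M.domain, α₀ ≤ α p) → IntegrableOn α M.domain →
        MemLp β ∞ (volume.restrict M.domain) →
        M.PiecewiseConst c →
        (∀ e : M.Edge, RectMesh.IsBoundaryEdge e → e.1.IntegrableAlong g) →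
        M.KappaCond C₀ C₁ κ α β c →
        M.lowerOrder C₀ C₁ β c ≤ κ →
        (∀ T ∈ M.elems, T.aspect ∈ Icc (1 / 2 : ℝ) 2) →
        (∀ p ∈ M.domain, f p ≤ 0) →
        RectMesh.IsSWGSolution κ α β c f g u →
        ((∀ p ∈ M.domain, c p = 0) →
          ∃ K Kb : ℝ, IsGreatest (range u) K ∧
            IsGreatest ((fun e : M.Edge => e.1.Qb g) '' {e | RectMesh.IsBoundaryEdge e}) Kb ∧
            K ≤ Kb) ∧
        ((∀ p ∈ M.domain, 0 ≤ c p) →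
          ∃ K Kb : ℝ, IsGreatest (range u) K ∧
            IsGreatest ((fun e : M.Edge => max (e.1.Qb g) 0) '' {e | RectMesh.IsBoundaryEdge e})
              Kb ∧
            K ≤ Kb) := by
  -- `12 = 2 · 6`: the aspect ratio gives `s ≥ κ t / (6 h)` for either side length `t`, and half of
  -- `s` absorbs the lower-order terms.
  refine ⟨12, 12, by norm_num, by norm_num, ?_⟩
  intro M κ α₀ α β c f g u hκ hα₀ hα hαi hβ hc _ hcond hκL hσ hf hu
  obtain ⟨e₀, he₀⟩ := Finite.exists_max u
  have hK : IsGreatest (range u) (u e₀) := ⟨⟨e₀, rfl⟩, forall_mem_range.2 he₀⟩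
  -- The trivial predicate shows that there is a boundary edge at all, so the boundary maximum
  -- exists.
  obtain ⟨eb, -, heb⟩ := RectMesh.exists_isBoundaryEdge (M := M) (P := fun _ => True)
    ⟨e₀, trivial⟩ fun _ _ _ _ _ => trivial
  have attained : ∀ φ : M.Edge → ℝ, ∃ Kb, IsGreatest (φ '' {e | RectMesh.IsBoundaryEdge e}) Kb :=
    fun φ => ((toFinite _).image φ).isCompact.exists_isGreatest ⟨_, mem_image_of_mem φ heb⟩
  have main := fun hc0 => RectMesh.exists_boundary_max hκ hα₀ hα hαi hβ hc hcond hκL hσ hf hu hc0 hK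
  constructor
  · intro hc0
    obtain ⟨Kb, hKb⟩ := attained fun e => e.1.Qb g
    refine ⟨u e₀, Kb, hK, hKb, ?_⟩
    obtain ⟨e, he, hb⟩ := main (fun p hp => (hc0 p hp).ge) fun p hp => by rw [hc0 p hp, zero_mul]
    rw [← he, hu.1 e hb]
    exact hKb.2 ⟨e, hb, rfl⟩
  · intro hc0
    obtain ⟨Kb, hKb⟩ := attained fun e => max (e.1.Qb g) 0
    refine ⟨u e₀, Kb, hK, hKb, ?_⟩
    -- A nonpositive maximum is below `max (Q_b g) 0` trivially; a nonnegative one satisfies `c K ≥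
    -- 0`.
    rcases le_total (u e₀) 0 with h0 | h0
    · exact h0.trans ((le_max_right _ _).trans (hKb.2 ⟨eb, heb, rfl⟩))
    · obtain ⟨e, he, hb⟩ := main hc0 fun p hp => mul_nonneg (hc0 p hp) h0
      rw [← he, hu.1 e hb]
      exact (le_max_left _ _).trans (hKb.2 ⟨e, hb, rfl⟩)
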